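/- Consider $n$ pursuers in the plane and a stationary target $T$. Pursuer $i$ has a constant speed $V_i>0$, position $P_i(t)$ and heading $\gamma_i(t)$, and moves by the unicycle kinematics $\dot P_i=V_i(\cos\gamma_i,\sin\gamma_i)$, $\dot\gamma_i=a_i/V_i$ (in the sense of Carathéodory). Let $R_i=|T-P_i|$, let $\theta_i\in(-\pi,\pi]$ be the lead angle, i.e. the oriented angle from the heading direction of pursuer $i$ to the line of sight from $P_i$ to $T$, and let $$\tilde t_i=\frac{R_i\theta_i}{V_i\sin\theta_i},\qquad a_i'=\frac{2V_i^2\sin\theta_i}{R_i}$$ be the estimated time of interception (the time needed to reach $T$ along the circular path) and the lateral acceleration of that circular path. Let $\mathcal G$ be a static communication digraph on the pursuers. As long as no pursuer has reached $T$, every pursuer $i$ follows the guidance law $$a_i=0\ \text{ if }\ \tilde t_i<\max_{j\in\mathcal N_{\mathrm{out}}(i)}\tilde t_j,\qquad a_i=a_i'\ \text{ otherwise},$$ where $\mathcal N_{\mathrm{out}}(i)$ is the set of out-neighbours of $i$. Assume that $P_i(0)\ne T$ and $\theta_i(0)\notin\{0,\pi\}$ for all $i$. A pursuer $l$ is a leader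 if $\tilde t_l(t)=\max_i\tilde t_i(t)$ at all times $t\ge 0$ before any pursuer has reached $T$. Suppose that $\mathcal G$ is complete, i.e. there is an edge from $i$ to $j$ for all $i\neq j$. Then every pursuer $i$ that is not a leader switches its trajectory exactly once, from a straight line to a circular arc: it reaches $T$, for the first time at some $t_f>0$, and there is exactly one $s\in(0,t_f)$ such that pursuer $i$ moves along a straight line on $[0,s]$, with $a_i=0$ on $[0,s)$, and along a circular arc on $[s,t_f]$, with $a_i=a_i'\neq0$ on $[s,t_f)$. -/

import Mathlib

open MeasureTheory Set

noncomputable section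

namespace Pursuit

/-! The plane is identified with `ℂ`. A pursuer has a position `p : ℂ`, a heading `γ : ℝ`
(its velocity is `V * exp (γ * I)`, that is `(V cos γ, V sin γ)`) and a constant speed `V`.
The stationary target is `T : ℂ`. -/

/-- The lead angle: the oriented angle in `(-π, π]` from the heading direction to the line of
sight from the position `p` to the target. With this orientation a positive turning rate is a
turn towards the target when the lead angle is in `(0, π)`. -/
def leadAngle (T p : ℂ) (γ : ℝ) : ℝ :=
  Complex.arg ((T - p) * Complex.exp (-((γ : ℂ) * Complex.I)))

/-- The lateral acceleration `2 V² sin θ / R` of the circular path to the target. -/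
def circularAccel (T : ℂ) (V : ℝ) (p : ℂ) (γ : ℝ) : ℝ :=
  2 * V ^ 2 * Real.sin (leadAngle T p γ) / dist p T

/-- The estimated time of interception `R θ / (V sin θ)`: the time that the circular path to the
target takes. -/
def estTime (T : ℂ) (V : ℝ) (p : ℂ) (γ : ℝ) : ℝ :=
  dist p T * leadAngle T p γ / (V * Real.sin (leadAngle T p γ))

variable {n : ℕ}

open Classical in
/-- The guidance law: pursuer `i` applies no lateral acceleration when its estimated time of
interception is smaller than the largest one among its out-neighbours, and the lateral
acceleration of the circular path to the target otherwise. -/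
def guidanceAccel (G : Digraph (Fin n)) (T : ℂ) (V : Fin n → ℝ) (p : Fin n → ℂ)
    (γ : Fin n → ℝ) (i : Fin n) : ℝ :=
  if ∃ j, G.Adj i j ∧ estTime T (V i) (p i) (γ i) < estTime T (V j) (p j) (γ j) then 0
  else circularAccel T (V i) (p i) (γ i)

/-- The engagement is still going on at time `t`: no pursuer has reached the target so far. -/
def Engaged (T : ℂ) (P : Fin n → ℝ → ℂ) (t : ℝ) : Prop :=
  0 ≤ t ∧ ∀ j, ∀ s ∈ Icc 0 t, P j s ≠ T

/-- The motion `t ↦ (P i t, γ i t)` of `n` pursuers is a (Carathéodory) solution of the unicycle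
kinematics `P' = V exp (γ I)`, `γ' = a / V` under the guidance law, for as long as the engagement
is going on. Nothing is required after that, except that positions stay continuous. -/
structure IsGuidedMotion (G : Digraph (Fin n)) (T : ℂ) (V : Fin n → ℝ)
    (P : Fin n → ℝ → ℂ) (γ : Fin n → ℝ → ℝ) : Prop where
  continuousOn_position : ∀ i, ContinuousOn (P i) (Ici 0)
  intervalIntegrable_turnRate : ∀ i t, Engaged T P t →
    IntervalIntegrable (fun s => guidanceAccel G T V (fun j => P j s) (fun j => γ j s) i / V i)
      volume 0 t
  heading_eq : ∀ i t, Engaged T P t →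
    γ i t = γ i 0 +
      ∫ s in (0 : ℝ)..t, guidanceAccel G T V (fun j => P j s) (fun j => γ j s) i / V i
  position_eq : ∀ i t, Engaged T P t →
    P i t = P i 0 + ∫ s in (0 : ℝ)..t, (V i : ℂ) * Complex.exp ((γ i s : ℂ) * Complex.I)

/-- Pursuer `l` is a leader: throughout the engagement its estimated time of interception is the
largest one. -/
def IsLeader (T : ℂ) (V : Fin n → ℝ) (P : Fin n → ℝ → ℂ) (γ : Fin n → ℝ → ℝ)
    (l : Fin n) : Prop :=
  ∀ t, Engaged T P t →
    ∀ i, estTime T (V i) (P i t) (γ i t) ≤ estTime T (V l) (P l t) (γ l t)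

/-- The path `p` moves along a straight line (with constant nonzero velocity) on `[a, b]`. -/
def IsStraightOn (p : ℝ → ℂ) (a b : ℝ) : Prop :=
  ∃ v : ℂ, v ≠ 0 ∧ ∀ t ∈ Icc a b, p t = p a + ((t - a : ℝ) : ℂ) * v

/-- The path `p` moves along an arc of a (nondegenerate) circle with centre `c`, at a constant
nonzero angular velocity `ω`, on `[a, b]`. -/
def IsCircularArcOn (p : ℝ → ℂ) (a b : ℝ) : Prop :=
  ∃ (c : ℂ) (ω : ℝ), p a ≠ c ∧ ω ≠ 0 ∧
    ∀ t ∈ Icc a b, p t = c + (p a - c) * Complex.exp (((ω * (t - a) : ℝ) : ℂ) * Complex.I)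

end Pursuit

end

/-! In the moving frame of a pursuer the target has coordinates `(x, y)` with `x' = -V + g y`, `y' =
-g x`, where `g` is the turning rate, and `y` never vanishes (a Grönwall estimate). Differentiating
the estimated time `τ = Rθ / (V sin θ)` shows that `τ + t` has derivative `0` on the circular path
and `2 (1 - θ cot θ) ≥ 0` on a straight line. So each `τ_i + t` is nondecreasing. The control jumps,
so all of this holds only for almost every `t` and is integrated through absolute continuity.

In a complete digraph a pursuer turns exactly when its `τ_i` is maximal, so the maximum of the `τ_i
+ t` is a constant `S` (`exists_max`). A pursuer with `τ_i + t = S` is stuck there by monotonicity: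
once circling, it circles until the end (`mem_circularTimes_of_le`).

While circling, `θ = Vκ(S - t)` and `κR = sin θ` with `κ` constant, so `T` is reached at `S` and not
earlier; a straight line from the initial position misses `T` because `θ(0) ≠ 0`. Hence the
engagement lasts exactly for `[0, S)` (`engaged_iff`). Since `R ≤ Vτ ≤ V(S - t)`, a pursuer going
straight on all of `[0, S)` would also end at `T`, which is impossible (`exists_mem_circularTimes`).
A pursuer circling at time `0` is a leader, so a non-leader starts straight and switches at the
first time when `τ_i + t = S`. -/

/-! ### Absolutely continuous functions and their maxima. -/

namespace AbsolutelyContinuousOnInterval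

/-- A function whose increments are dominated by those of an absolutely continuous function is
absolutely continuous. -/
theorem of_dist_le {X Y : Type*} [PseudoMetricSpace X] [PseudoMetricSpace Y] {f : ℝ → X}
    {g : ℝ → Y} {a b K : ℝ} (hf : AbsolutelyContinuousOnInterval f a b)
    (h : ∀ x ∈ uIcc a b, ∀ y ∈ uIcc a b, dist (g x) (g y) ≤ K * dist (f x) (f y)) :
    AbsolutelyContinuousOnInterval g a b := by
  rw [absolutelyContinuousOnInterval_iff] at hf ⊢
  intro ε hε
  obtain ⟨δ, hδ, H⟩ := hf (ε / (|K| + 1)) (by positivity)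
  refine ⟨δ, hδ, fun E hE hsum => ?_⟩
  have h1 := H E hE hsum
  calc ∑ i ∈ Finset.range E.1, dist (g (E.2 i).1) (g (E.2 i).2)
      ≤ ∑ i ∈ Finset.range E.1, (|K| + 1) * dist (f (E.2 i).1) (f (E.2 i).2) := by
        refine Finset.sum_le_sum fun i hi => ?_
        refine (h _ (hE.1 i hi).1 _ (hE.1 i hi).2).trans ?_
        have := le_abs_self K
        gcongr
        linarith
    _ = (|K| + 1) * ∑ i ∈ Finset.range E.1, dist (f (E.2 i).1) (f (E.2 i).2) := by
        rw [Finset.mul_sum]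
    _ < (|K| + 1) * (ε / (|K| + 1)) := by gcongr
    _ = ε := by field_simp

theorem congr_on {f g : ℝ → ℝ} {a b : ℝ} (hf : AbsolutelyContinuousOnInterval f a b)
    (h : EqOn g f (uIcc a b)) : AbsolutelyContinuousOnInterval g a b :=
  hf.of_dist_le (K := 1) fun x hx y hy => by rw [h hx, h hy, one_mul]

theorem abs {f : ℝ → ℝ} {a b : ℝ} (hf : AbsolutelyContinuousOnInterval f a b) :
    AbsolutelyContinuousOnInterval (fun t => |f t|) a b :=
  hf.of_dist_le (K := 1) fun x _ y _ => by
    rw [one_mul, Real.dist_eq, Real.dist_eq]; exact abs_abs_sub_abs_le _ _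

theorem const (c a b : ℝ) : AbsolutelyContinuousOnInterval (fun _ => c) a b :=
  ContDiffOn.absolutelyContinuousOnInterval contDiffOn_const

theorem id (a b : ℝ) : AbsolutelyContinuousOnInterval (fun t : ℝ => t) a b :=
  ContDiffOn.absolutelyContinuousOnInterval contDiffOn_id

/-- The image of the interval is compact and convex, and a `C¹` function is Lipschitz on such a set.
-/
theorem comp_contDiffAt {f g : ℝ → ℝ} {a b : ℝ} (hf : AbsolutelyContinuousOnInterval f a b)
    (hg : ∀ t ∈ uIcc a b, ContDiffAt ℝ 1 g (f t)) :
    AbsolutelyContinuousOnInterval (fun t => g (f t)) a b := by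
  have hconv : Convex ℝ (f '' uIcc a b) :=
    (isPreconnected_uIcc.image f hf.continuousOn).ordConnected.convex
  have hcomp : IsCompact (f '' uIcc a b) := isCompact_uIcc.image_of_continuousOn hf.continuousOn
  have hgd : ContDiffOn ℝ 1 g (f '' uIcc a b) := by
    rintro _ ⟨t, ht, rfl⟩
    exact (hg t ht).contDiffWithinAt
  obtain ⟨K, hK⟩ := hgd.exists_lipschitzOnWith (by decide) hconv hcomp
  exact hf.of_dist_le (K := K) fun x hx y hy =>
    hK.dist_le_mul _ (mem_image_of_mem f hx) _ (mem_image_of_mem f hy)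

theorem sup {f g : ℝ → ℝ} {a b : ℝ} (hf : AbsolutelyContinuousOnInterval f a b)
    (hg : AbsolutelyContinuousOnInterval g a b) : AbsolutelyContinuousOnInterval (f ⊔ g) a b := by
  refine ((hf.add hg).add (hf.sub hg).abs).of_dist_le (K := 1 / 2)
    fun x _ y _ => le_of_eq ?_
  have hmax : ∀ u v : ℝ, u ⊔ v = (1 / 2) * (u + v + |u - v|) := by
    intro u v
    rcases le_total u v with h | h
    · rw [sup_eq_right.2 h, abs_of_nonpos (by linarith)]; ring
    · rw [sup_eq_left.2 h, abs_of_nonneg (by linarith)]; ring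
  simp only [Pi.sup_apply, Pi.add_apply, Pi.sub_apply, hmax, Real.dist_eq, ← mul_sub, abs_mul]
  norm_num

/-- An absolutely continuous function whose derivative is almost everywhere nonnegative is
monotone. -/
theorem monotoneOn_of_ae_deriv_nonneg {f : ℝ → ℝ} {a b : ℝ}
    (hf : AbsolutelyContinuousOnInterval f a b)
    (h : ∀ᵐ t, t ∈ Ioo a b → ∃ d, 0 ≤ d ∧ HasDerivAt f d t) : MonotoneOn f (Icc a b) := by
  intro x hx y hy hxy
  have hsub : uIcc x y ⊆ uIcc a b := by
    rw [uIcc_of_le hxy, uIcc_of_le (hx.1.trans hx.2)]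
    exact Icc_subset_Icc hx.1 hy.2
  rw [← sub_nonneg, ← (hf.mono hsub).integral_deriv_eq_sub,
    intervalIntegral.integral_of_le hxy, integral_Ioc_eq_integral_Ioo]
  refine integral_nonneg_of_ae ?_
  rw [Filter.EventuallyLE, ae_restrict_iff' measurableSet_Ioo]
  filter_upwards [h] with t ht htm
  obtain ⟨d, hd, hdt⟩ := ht ⟨hx.1.trans_lt htm.1, htm.2.trans_le hy.2⟩
  rw [hdt.deriv]; exact hd

theorem eq_left_of_ae_deriv_zero {f : ℝ → ℝ} {a b : ℝ}
    (hf : AbsolutelyContinuousOnInterval f a b)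
    (h : ∀ᵐ t, t ∈ Ioo a b → HasDerivAt f 0 t) : ∀ t ∈ Icc a b, f t = f a := by
  intro t ht
  have ha : a ∈ Icc a b := ⟨le_rfl, ht.1.trans ht.2⟩
  have h1 := hf.monotoneOn_of_ae_deriv_nonneg
    (by filter_upwards [h] with s hs hsm using ⟨0, le_rfl, hs hsm⟩) ha ht ht.1
  have h2 := hf.neg.monotoneOn_of_ae_deriv_nonneg
    (by
      filter_upwards [h] with s hs hsm
      exact ⟨0, le_rfl, by simpa using (hs hsm).neg⟩) ha ht ht.1
  simp only [Pi.neg_apply] at h2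
  linarith

/-- If every member of a finite family of absolutely continuous functions is almost everywhere
stationary where it is maximal, then the maximum of the family is constant. -/
theorem sup'_eq_left {ι : Type*} {s : Finset ι} (hs : s.Nonempty) {f : ι → ℝ → ℝ} {a b : ℝ}
    (hf : ∀ i ∈ s, AbsolutelyContinuousOnInterval (f i) a b)
    (h : ∀ i ∈ s, ∀ᵐ t, t ∈ Ioo a b → (∀ j ∈ s, f j t ≤ f i t) → HasDerivAt (f i) 0 t) :
    ∀ t ∈ Icc a b, s.sup' hs (fun i => f i t) = s.sup' hs (fun i => f i a) := by
  intro t ht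
  have hab : a ≤ b := ht.1.trans ht.2
  have hac : AbsolutelyContinuousOnInterval (s.sup' hs f) a b :=
    Finset.sup'_induction (p := fun g => AbsolutelyContinuousOnInterval g a b) hs f
      (fun _ h₁ _ h₂ => AbsolutelyContinuousOnInterval.sup h₁ h₂) hf
  have hd : ∀ᵐ t, t ∈ Ioo a b → HasDerivAt (s.sup' hs f) 0 t := by
    have h' : ∀ᵐ t, ∀ i : s, t ∈ Ioo a b → (∀ j ∈ s, f j t ≤ f i t) → HasDerivAt (f i) 0 t :=
      ae_all_iff.2 fun i => h i i.2
    filter_upwards [h', hac.ae_differentiableAt] with t h1 h2 htm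
    have hdiff := h2 (by rw [uIcc_of_le hab]; exact Ioo_subset_Icc_self htm)
    obtain ⟨i, his, hi⟩ := s.exists_mem_eq_sup' hs (fun i => f i t)
    have hmax : ∀ j ∈ s, f j t ≤ f i t := fun j hj => by
      rw [← hi]; exact s.le_sup' (fun i => f i t) hj
    have hid := h1 ⟨i, his⟩ htm hmax
    -- The maximum minus a member attaining it at `t` is nonnegative and vanishes at `t`, so where
    -- both are differentiable their derivatives agree.
    have hmin : IsLocalMin (s.sup' hs f - f i) t := by
      refine Filter.Eventually.of_forall fun u => ?_
      have : f i u ≤ s.sup' hs (fun i => f i u) := s.le_sup' (fun i => f i u) his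
      simp only [Pi.sub_apply, Finset.sup'_apply, hi]
      linarith
    have h0 := hmin.hasDerivAt_eq_zero (hdiff.hasDerivAt.sub hid)
    rw [sub_zero] at h0
    rw [← h0]
    exact hdiff.hasDerivAt
  simpa only [Finset.sup'_apply] using hac.eq_left_of_ae_deriv_zero hd t ht

end AbsolutelyContinuousOnInterval

/-! ### Dynamics of the target in the moving frame of one pursuer. -/

namespace Pursuit

/-- The coordinates `(x, y)` of the target in the moving frame of a pursuer of speed `V`, which
follows the circular path to the target at the times in `C` and moves straight at other times. -/
structure IsRelMotion (V : ℝ) (C : Set ℝ) (x y : ℝ → ℝ) (a b : ℝ) : Prop where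
  le : a ≤ b
  ac_fst : AbsolutelyContinuousOnInterval x a b
  ac_snd : AbsolutelyContinuousOnInterval y a b
  pos : ∀ t ∈ Icc a b, 0 < x t ^ 2 + y t ^ 2
  deriv : ∀ᵐ t, t ∈ Ioo a b → ∃ g : ℝ, HasDerivAt x (-V + g * y t) t ∧
    HasDerivAt y (-(g * x t)) t ∧ (t ∈ C → g = 2 * V * y t / (x t ^ 2 + y t ^ 2)) ∧
    (t ∉ C → g = 0)

/-- The estimated time of interception in terms of the coordinates of the target in the moving
frame of the pursuer, for `y > 0`. -/
noncomputable def relTime (V x y : ℝ) : ℝ :=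
  (x ^ 2 + y ^ 2) * (Real.pi / 2 - Real.arctan (x / y)) / (V * y)

/-- With `q = cot θ` this is `θ cot θ ≤ 1`, the inequality that makes `τ + t` nondecreasing along a
straight line. -/
theorem mul_arccot_le_one (q : ℝ) : q * (Real.pi / 2 - Real.arctan q) ≤ 1 := by
  rcases le_or_gt q 0 with hq | hq
  · have := Real.arctan_lt_pi_div_two q
    nlinarith
  · have h1 : Real.arctan q⁻¹ ≤ q⁻¹ := by
      simpa only [Real.tan_arctan] using Real.le_tan (Real.arctan_nonneg.2 (inv_nonneg.2 hq.le))
        (Real.arctan_lt_pi_div_two q⁻¹)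
    rw [Real.arctan_inv_of_pos hq] at h1
    calc q * (Real.pi / 2 - Real.arctan q) ≤ q * q⁻¹ := by gcongr
      _ = 1 := mul_inv_cancel₀ hq.ne'

theorem relTime_pos {V x y : ℝ} (hV : 0 < V) (hy : 0 < y) : 0 < relTime V x y := by
  have := Real.arctan_lt_pi_div_two (x / y)
  have : 0 < Real.pi / 2 - Real.arctan (x / y) := by linarith
  unfold relTime
  positivity

/-- With `q = x / y = cot θ`, the rate for `g = 0` is `1 - 2qθ`. On the circular path the factor
after `g` makes the coefficient of `qθ - 1` equal to `2`, and the rate is `-1`. -/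
theorem hasDerivAt_relTime {V g t : ℝ} {x y : ℝ → ℝ} (hV : 0 < V) (hy : 0 < y t)
    (hx' : HasDerivAt x (-V + g * y t) t) (hy' : HasDerivAt y (-(g * x t)) t) :
    HasDerivAt (fun s => relTime V (x s) (y s))
      (1 - 2 * (x t / y t) * (Real.pi / 2 - Real.arctan (x t / y t)) +
        g * (x t ^ 2 + y t ^ 2) / (V * y t) *
          (x t / y t * (Real.pi / 2 - Real.arctan (x t / y t)) - 1)) t := by
  have h1 := ((hx'.fun_pow 2).fun_add (hy'.fun_pow 2)).fun_mul
    (((hx'.fun_div hy' hy.ne').arctan).const_sub (Real.pi / 2))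
  have h2 := h1.fun_div (hy'.const_mul V) (by positivity)
  refine h2.congr_deriv ?_
  have : 0 < x t ^ 2 + y t ^ 2 := by positivity
  generalize Real.arctan (x t / y t) = A
  have h3 : 1 + (x t / y t) ^ 2 = (x t ^ 2 + y t ^ 2) / y t ^ 2 := by field_simp; ring
  rw [h3]
  field_simp
  ring

namespace IsRelMotion

variable {V : ℝ} {C : Set ℝ} {x y : ℝ → ℝ} {a b : ℝ}

theorem mono (h : IsRelMotion V C x y a b) {c d : ℝ} (hac : a ≤ c) (hcd : c ≤ d) (hdb : d ≤ b) :
    IsRelMotion V C x y c d := by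
  have hsub : uIcc c d ⊆ uIcc a b := by
    rw [uIcc_of_le hcd, uIcc_of_le h.le]
    exact Icc_subset_Icc hac hdb
  refine ⟨hcd, h.ac_fst.mono hsub, h.ac_snd.mono hsub,
    fun t ht => h.pos t ⟨hac.trans ht.1, ht.2.trans hdb⟩, ?_⟩
  filter_upwards [h.deriv] with t ht htm
  exact ht ⟨hac.trans_lt htm.1, htm.2.trans_le hdb⟩

theorem ac_normSq (h : IsRelMotion V C x y a b) :
    AbsolutelyContinuousOnInterval (fun t => x t ^ 2 + y t ^ 2) a b :=
  ((h.ac_fst.mul h.ac_fst).add (h.ac_snd.mul h.ac_snd)).congr_on fun t _ => by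
    simp only [Pi.add_apply, Pi.mul_apply]; ring

theorem continuousOn_fst (h : IsRelMotion V C x y a b) : ContinuousOn x (Icc a b) := by
  simpa only [uIcc_of_le h.le] using h.ac_fst.continuousOn

theorem continuousOn_snd (h : IsRelMotion V C x y a b) : ContinuousOn y (Icc a b) := by
  simpa only [uIcc_of_le h.le] using h.ac_snd.continuousOn

/-- The target stays on the side of the heading line on which it is at the start. -/
theorem snd_ne_zero (h : IsRelMotion V C x y a b) (hV : 0 < V) (ha : y a ≠ 0) :
    ∀ t ∈ Icc a b, y t ≠ 0 := by
  intro t ht hyt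
  -- The maximum `K` of this function bounds `g x / y` in both modes, so `y² exp (2Kt)` is
  -- nondecreasing and cannot fall from a positive value to `0`.
  have hcont : ContinuousOn (fun t => 2 * V * |x t| / (x t ^ 2 + y t ^ 2)) (Icc a b) := by
    refine ContinuousOn.div ?_ ?_ fun s hs => (h.pos s hs).ne'
    · exact continuousOn_const.mul h.continuousOn_fst.abs
    · exact (h.continuousOn_fst.pow 2).add (h.continuousOn_snd.pow 2)
  obtain ⟨K, hK⟩ := isCompact_Icc.bddAbove_image hcont
  have hK' : ∀ s ∈ Icc a b, 2 * V * |x s| / (x s ^ 2 + y s ^ 2) ≤ K := fun s hs =>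
    hK (mem_image_of_mem _ hs)
  have hexp : AbsolutelyContinuousOnInterval (fun t => Real.exp (2 * K * t)) a b :=
    ContDiffOn.absolutelyContinuousOnInterval (by fun_prop)
  have hmono := ((h.ac_snd.mul h.ac_snd).mul hexp).monotoneOn_of_ae_deriv_nonneg (by
    filter_upwards [h.deriv] with s hs hsm
    obtain ⟨g, -, hy', hgC, hgC'⟩ := hs hsm
    have hsI := Ioo_subset_Icc_self hsm
    have hr := h.pos s hsI
    have hd := (hy'.mul hy').mul (((hasDerivAt_id s).const_mul (2 * K)).exp)
    refine ⟨_, ?_, hd⟩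
    have hgx : g * x s * y s ≤ K * (y s * y s) := by
      have hK0 := hK' s hsI
      by_cases hsC : s ∈ C
      · rw [hgC hsC]
        have : 2 * V * y s / (x s ^ 2 + y s ^ 2) * x s * y s
            = 2 * V * x s / (x s ^ 2 + y s ^ 2) * (y s * y s) := by ring
        rw [this]
        refine mul_le_mul_of_nonneg_right (le_trans ?_ hK0) (mul_self_nonneg _)
        have := le_abs_self (x s)
        gcongr
      · rw [hgC' hsC]
        have : 0 ≤ K := le_trans (by positivity) hK0
        have := mul_nonneg this (mul_self_nonneg (y s))
        linarith
    have he := (Real.exp_pos (2 * K * s)).le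
    simp only [Pi.mul_apply, id, mul_one]
    have : (-(g * x s) * y s + y s * -(g * x s)) * Real.exp (2 * K * s) +
        y s * y s * (Real.exp (2 * K * s) * (2 * K)) =
        2 * (K * (y s * y s) - g * x s * y s) * Real.exp (2 * K * s) := by ring
    rw [this]
    exact mul_nonneg (by linarith) he)
  have := hmono ⟨le_rfl, h.le⟩ ht ht.1
  simp only [Pi.mul_apply, hyt] at this
  have h1 : 0 < y a * y a * Real.exp (2 * K * a) :=
    mul_pos (mul_self_pos.2 ha) (Real.exp_pos _)
  linarith

/-- Reflection in the heading line changes the signs of `y` and `g` and preserves the equations, so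
only `y > 0` needs to be studied. -/
theorem abs_snd (h : IsRelMotion V C x y a b) (hy : ∀ t ∈ Icc a b, y t ≠ 0) :
    IsRelMotion V C x (fun t => |y t|) a b := by
  refine ⟨h.le, h.ac_fst, h.ac_snd.abs, fun t ht => by simpa only [sq_abs] using h.pos t ht, ?_⟩
  filter_upwards [h.deriv] with t ht htm
  obtain ⟨g, hx', hy', hgC, hgC'⟩ := ht htm
  rcases (hy t (Ioo_subset_Icc_self htm)).lt_or_gt with hyt | hyt
  · refine ⟨-g, ?_, ?_, fun hC => ?_, fun hC => by rw [hgC' hC, neg_zero]⟩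
    · rw [abs_of_neg hyt, neg_mul_neg]; exact hx'
    · exact ((hasDerivAt_abs_neg hyt).comp t hy').congr_deriv (by ring)
    · rw [hgC hC, sq_abs, abs_of_neg hyt]; ring
  · refine ⟨g, ?_, ?_, fun hC => ?_, hgC'⟩
    · rw [abs_of_pos hyt]; exact hx'
    · exact ((hasDerivAt_abs_pos hyt).comp t hy').congr_deriv (by ring)
    · rw [hgC hC, sq_abs, abs_of_pos hyt]

theorem ac_relTime_add (h : IsRelMotion V C x y a b) (hV : 0 < V) (hy : ∀ t ∈ Icc a b, 0 < y t) :
    AbsolutelyContinuousOnInterval (fun t => relTime V (x t) (y t) + t) a b := by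
  rw [← uIcc_of_le h.le] at hy
  have hinv : AbsolutelyContinuousOnInterval (fun t => (y t)⁻¹) a b :=
    h.ac_snd.comp_contDiffAt fun t ht => contDiffAt_inv ℝ (hy t ht).ne'
  have hang := (h.ac_fst.mul hinv).comp_contDiffAt (g := fun q => Real.pi / 2 - Real.arctan q)
    fun t _ => (contDiff_const.sub Real.contDiff_arctan).contDiffAt
  refine ((((h.ac_normSq.mul hang).mul hinv).const_mul V⁻¹).add
    (AbsolutelyContinuousOnInterval.id a b)).congr_on fun t ht => ?_
  have := hy t ht
  simp only [Pi.mul_apply, Pi.add_apply, relTime]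
  field_simp

theorem ae_hasDerivAt_relTime_add (h : IsRelMotion V C x y a b) (hV : 0 < V)
    (hy : ∀ t ∈ Icc a b, 0 < y t) :
    ∀ᵐ t, t ∈ Ioo a b → ∃ d, 0 ≤ d ∧ (t ∈ C → d = 0) ∧
      HasDerivAt (fun t => relTime V (x t) (y t) + t) d t := by
  filter_upwards [h.deriv] with t ht htm
  obtain ⟨g, hx', hy', hgC, hgC'⟩ := ht htm
  have htI := Ioo_subset_Icc_self htm
  have hyt := hy t htI
  have hr := h.pos t htI
  have hd := (hasDerivAt_relTime hV hyt hx' hy').fun_add (hasDerivAt_id' t)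
  by_cases hC : t ∈ C
  · refine ⟨0, le_rfl, fun _ => rfl, hd.congr_deriv ?_⟩
    rw [hgC hC]
    have : 2 * V * y t / (x t ^ 2 + y t ^ 2) * (x t ^ 2 + y t ^ 2) / (V * y t) = 2 := by
      field_simp
    rw [this]; ring
  · refine ⟨_, ?_, fun h => absurd h hC, hd⟩
    rw [hgC' hC]
    have := mul_arccot_le_one (x t / y t)
    rw [zero_mul, zero_div, zero_mul]
    linarith

/-- On the circular path, `y / (x² + y²)` is constant. -/
theorem snd_div_normSq_eq (h : IsRelMotion V C x y a b) (hC : ∀ t ∈ Icc a b, t ∈ C) :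
    ∀ t ∈ Icc a b, y t / (x t ^ 2 + y t ^ 2) = y a / (x a ^ 2 + y a ^ 2) := by
  have hinv : AbsolutelyContinuousOnInterval (fun t => (x t ^ 2 + y t ^ 2)⁻¹) a b :=
    h.ac_normSq.comp_contDiffAt fun t ht =>
      contDiffAt_inv ℝ (h.pos t (by rwa [uIcc_of_le h.le] at ht)).ne'
  have hac : AbsolutelyContinuousOnInterval (fun t => y t / (x t ^ 2 + y t ^ 2)) a b :=
    (h.ac_snd.mul hinv).congr_on fun t _ => rfl
  refine hac.eq_left_of_ae_deriv_zero ?_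
  filter_upwards [h.deriv] with t ht htm
  obtain ⟨g, hx', hy', hgC, -⟩ := ht htm
  have htI := Ioo_subset_Icc_self htm
  have hr := h.pos t htI
  refine (hy'.fun_div ((hx'.fun_pow 2).fun_add (hy'.fun_pow 2)) hr.ne').congr_deriv ?_
  rw [hgC (hC t htI)]
  field_simp
  ring

end IsRelMotion

/-! ### Lead angle, distance and estimated time in complex form. -/

/-- The position of the target in the moving frame of a pursuer. -/
noncomputable def relPos (T p : ℂ) (γ : ℝ) : ℂ := (T - p) * Complex.exp (-((γ : ℂ) * Complex.I))

theorem exp_neg_mul_I (γ : ℝ) : Complex.exp (-((γ : ℂ) * Complex.I)) =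
    ((Real.cos γ : ℝ) : ℂ) - ((Real.sin γ : ℝ) : ℂ) * Complex.I := by
  rw [← neg_mul, Complex.exp_mul_I, Complex.cos_neg, Complex.sin_neg, Complex.ofReal_cos,
    Complex.ofReal_sin]
  ring

theorem re_relPos (T p : ℂ) (γ : ℝ) :
    (relPos T p γ).re = (T - p).re * Real.cos γ + (T - p).im * Real.sin γ := by
  simp [relPos, exp_neg_mul_I, -Complex.ofReal_cos, -Complex.ofReal_sin]

theorem im_relPos (T p : ℂ) (γ : ℝ) :
    (relPos T p γ).im = (T - p).im * Real.cos γ - (T - p).re * Real.sin γ := by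
  simp [relPos, exp_neg_mul_I, -Complex.ofReal_cos, -Complex.ofReal_sin]
  ring

theorem norm_relPos (T p : ℂ) (γ : ℝ) : ‖relPos T p γ‖ = dist p T := by
  rw [relPos, norm_mul, ← neg_mul, ← Complex.ofReal_neg, Complex.norm_exp_ofReal_mul_I, mul_one,
    dist_comm, dist_eq_norm]

theorem dist_sq_eq (T p : ℂ) (γ : ℝ) :
    dist p T ^ 2 = (relPos T p γ).re ^ 2 + (relPos T p γ).im ^ 2 := by
  rw [← norm_relPos T p γ, Complex.sq_norm, Complex.normSq_apply]; ring

theorem leadAngle_eq_arg (T p : ℂ) (γ : ℝ) : leadAngle T p γ = (relPos T p γ).arg := rfl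

theorem dist_mul_sin_leadAngle (T p : ℂ) (γ : ℝ) :
    dist p T * Real.sin (leadAngle T p γ) = (relPos T p γ).im := by
  rw [← norm_relPos T p γ, leadAngle_eq_arg, Complex.norm_mul_sin_arg]

theorem arg_eq_of_im_pos {z : ℂ} (hz : 0 < z.im) :
    z.arg = Real.pi / 2 - Real.arctan (z.re / z.im) := by
  have h1 := Real.arctan_mem_Ioo (z.re / z.im)
  have hcos := Real.cos_arctan_pos (z.re / z.im)
  have hr : 0 < z.im / Real.cos (Real.arctan (z.re / z.im)) := by positivity
  have hs : Real.sin (Real.arctan (z.re / z.im)) =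
      z.re / z.im * Real.cos (Real.arctan (z.re / z.im)) := by
    rw [← Real.tan_mul_cos hcos.ne', Real.tan_arctan]
  rw [← Complex.arg_mul_cos_add_sin_mul_I hr
    (θ := Real.pi / 2 - Real.arctan (z.re / z.im)) ⟨by linarith [h1.2, Real.pi_pos],
      by linarith [h1.1]⟩, ← Complex.ofReal_cos, ← Complex.ofReal_sin, Real.cos_pi_div_two_sub,
      Real.sin_pi_div_two_sub, hs]
  congr 1
  apply Complex.ext
  · simp only [Complex.mul_re, Complex.add_re, Complex.ofReal_re, Complex.ofReal_im,
      Complex.I_re, Complex.I_im, Complex.add_im, Complex.mul_im]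
    field_simp
    ring
  · simp only [Complex.mul_re, Complex.add_re, Complex.ofReal_re, Complex.ofReal_im,
      Complex.I_re, Complex.I_im, Complex.add_im, Complex.mul_im]
    field_simp
    ring

/-- Conjugation changes the sign of both `arg` and `im`, so the quotient depends only on `|im|`. -/
theorem arg_div_im {z : ℂ} (hz : z.im ≠ 0) :
    z.arg / z.im = (Real.pi / 2 - Real.arctan (z.re / |z.im|)) / |z.im| := by
  rcases hz.lt_or_gt with h | h
  · have h1 : 0 < ((starRingEnd ℂ) z).im := by simpa using h
    have h2 := arg_eq_of_im_pos h1
    rw [Complex.arg_conj, if_neg (fun hc => h.ne (Complex.arg_eq_pi_iff.1 hc).2),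
      Complex.conj_re, Complex.conj_im, ← abs_of_neg h] at h2
    rw [← h2, abs_of_neg h, neg_div_neg_eq]
  · rw [arg_eq_of_im_pos h, abs_of_pos h]

theorem estTime_eq_div {T p : ℂ} {γ V : ℝ} (hp : p ≠ T) :
    estTime T V p γ = leadAngle T p γ /
      (V * ((relPos T p γ).im / ((relPos T p γ).re ^ 2 + (relPos T p γ).im ^ 2))) := by
  have hd : dist p T ≠ 0 := dist_ne_zero.2 hp
  rw [← dist_sq_eq, ← dist_mul_sin_leadAngle, estTime]
  -- If `V` or the sine vanishes, both sides are divisions by zero, hence `0`.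
  by_cases hV : V = 0
  · simp [hV]
  by_cases hs : Real.sin (leadAngle T p γ) = 0
  · simp [hs]
  field_simp

theorem estTime_eq_relTime {T p : ℂ} {γ V : ℝ} (hV : 0 < V) (hp : p ≠ T)
    (him : (relPos T p γ).im ≠ 0) :
    estTime T V p γ = relTime V (relPos T p γ).re |(relPos T p γ).im| := by
  have hd : 0 < dist p T := dist_pos.2 hp
  have hr : 0 < (relPos T p γ).re ^ 2 + (relPos T p γ).im ^ 2 := by
    rw [← dist_sq_eq]; positivity
  rw [estTime_eq_div hp, relTime, sq_abs, leadAngle_eq_arg]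
  calc _ = ((relPos T p γ).re ^ 2 + (relPos T p γ).im ^ 2) / V *
        ((relPos T p γ).arg / (relPos T p γ).im) := by field_simp
    _ = _ := by
      have := abs_pos.2 him
      rw [arg_div_im him]; field_simp

theorem circularAccel_div {T p : ℂ} {γ V : ℝ} (hV : 0 < V) (hp : p ≠ T) :
    circularAccel T V p γ / V =
      2 * V * (relPos T p γ).im / ((relPos T p γ).re ^ 2 + (relPos T p γ).im ^ 2) := by
  have hd : dist p T ≠ 0 := dist_ne_zero.2 hp
  rw [← dist_sq_eq, ← dist_mul_sin_leadAngle, circularAccel]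
  field_simp

theorem im_relPos_ne_zero {T p : ℂ} {γ : ℝ} (h0 : leadAngle T p γ ≠ 0)
    (hpi : leadAngle T p γ ≠ Real.pi) : (relPos T p γ).im ≠ 0 := by
  intro h
  rw [leadAngle_eq_arg] at h0 hpi
  rcases le_or_gt 0 (relPos T p γ).re with hre | hre
  · exact h0 (Complex.arg_eq_zero_iff.2 ⟨hre, h⟩)
  · exact hpi (Complex.arg_eq_pi_iff.2 ⟨hre, h⟩)

/-- The distance to the target is at most the distance travelled in the estimated time. -/
theorem dist_le_mul_estTime {T p : ℂ} {γ V : ℝ} (hV : 0 < V)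
    (h0 : leadAngle T p γ ≠ 0) (hpi : leadAngle T p γ ≠ Real.pi) :
    dist p T ≤ V * estTime T V p γ := by
  have hs : Real.sin (leadAngle T p γ) / leadAngle T p γ ≤ 1 := by
    refine (le_abs_self _).trans ?_
    rw [abs_div, div_le_one (abs_pos.2 h0)]
    exact Real.abs_sin_le_abs
  have hpos : 0 < Real.sin (leadAngle T p γ) / leadAngle T p γ := by
    have h1 := Complex.arg_mem_Ioc (relPos T p γ)
    rw [← leadAngle_eq_arg] at h1
    rcases h0.lt_or_gt with h | h
    · exact div_pos_of_neg_of_neg (Real.sin_neg_of_neg_of_neg_pi_lt h h1.1) h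
    · exact div_pos (Real.sin_pos_of_pos_of_lt_pi h (lt_of_le_of_ne h1.2 hpi)) h
  have : V * estTime T V p γ =
      dist p T * (Real.sin (leadAngle T p γ) / leadAngle T p γ)⁻¹ := by
    rw [estTime, inv_div]; field_simp
  rw [this]
  exact le_mul_of_one_le_right dist_nonneg ((one_le_inv₀ hpos).2 hs)

/-! ### Guided motions: regularity and relative dynamics. -/

variable {n : ℕ} {G : Digraph (Fin n)} {T : ℂ} {V : Fin n → ℝ} {P : Fin n → ℝ → ℂ}
  {γ : Fin n → ℝ → ℝ}

theorem Engaged.mono {s t : ℝ} (h : Engaged T P t) (hs : 0 ≤ s) (hst : s ≤ t) : Engaged T P s :=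
  ⟨hs, fun j u hu => h.2 j u ⟨hu.1, hu.2.trans hst⟩⟩

theorem Engaged.ne {t : ℝ} (h : Engaged T P t) (j : Fin n) : P j t ≠ T :=
  h.2 j t ⟨h.1, le_rfl⟩

/-- The times at which the guidance law tells pursuer `i` to follow the circular path. -/
def circularTimes (G : Digraph (Fin n)) (T : ℂ) (V : Fin n → ℝ) (P : Fin n → ℝ → ℂ)
    (γ : Fin n → ℝ → ℝ) (i : Fin n) : Set ℝ :=
  {t | ¬∃ j, G.Adj i j ∧ estTime T (V i) (P i t) (γ i t) < estTime T (V j) (P j t) (γ j t)}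

theorem guidanceAccel_of_mem {i : Fin n} {t : ℝ} (h : t ∈ circularTimes G T V P γ i) :
    guidanceAccel G T V (fun j => P j t) (fun j => γ j t) i =
      circularAccel T (V i) (P i t) (γ i t) := if_neg h

theorem guidanceAccel_of_notMem {i : Fin n} {t : ℝ} (h : t ∉ circularTimes G T V P γ i) :
    guidanceAccel G T V (fun j => P j t) (fun j => γ j t) i = 0 := if_pos (not_not.1 h)

namespace IsGuidedMotion

theorem ac_heading (h : IsGuidedMotion G T V P γ) (i : Fin n) {b : ℝ} (hb : Engaged T P b) :
    AbsolutelyContinuousOnInterval (γ i) 0 b := by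
  refine ((AbsolutelyContinuousOnInterval.const (γ i 0) 0 b).add
    ((h.intervalIntegrable_turnRate i b hb).absolutelyContinuousOnInterval_intervalIntegral
      left_mem_uIcc)).congr_on fun t ht => ?_
  rw [uIcc_of_le hb.1] at ht
  exact h.heading_eq i t (hb.mono ht.1 ht.2)

theorem intervalIntegrable_velocity (h : IsGuidedMotion G T V P γ) (i : Fin n) {b : ℝ}
    (hb : Engaged T P b) : IntervalIntegrable
      (fun s => (V i : ℂ) * Complex.exp ((γ i s : ℂ) * Complex.I)) volume 0 b := by
  have := (h.ac_heading i hb).continuousOn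
  refine ContinuousOn.intervalIntegrable ?_
  fun_prop

theorem ac_re_position (h : IsGuidedMotion G T V P γ) (i : Fin n) {b : ℝ} (hb : Engaged T P b) :
    AbsolutelyContinuousOnInterval (fun t => (P i t).re) 0 b := by
  have hint := h.intervalIntegrable_velocity i hb
  have hre : IntervalIntegrable
      (fun s => ((V i : ℂ) * Complex.exp ((γ i s : ℂ) * Complex.I)).re) volume 0 b :=
    ⟨hint.1.re, hint.2.re⟩
  refine ((AbsolutelyContinuousOnInterval.const (P i 0).re 0 b).add
    (hre.absolutelyContinuousOnInterval_intervalIntegral left_mem_uIcc)).congr_on fun t ht => ?_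
  rw [uIcc_of_le hb.1] at ht
  have ht' := hb.mono ht.1 ht.2
  have := Complex.reCLM.intervalIntegral_comp_comm (h.intervalIntegrable_velocity i ht')
  simp only [Complex.reCLM_apply] at this
  simp only [Pi.add_apply, this, h.position_eq i t ht', Complex.add_re]

theorem ac_im_position (h : IsGuidedMotion G T V P γ) (i : Fin n) {b : ℝ} (hb : Engaged T P b) :
    AbsolutelyContinuousOnInterval (fun t => (P i t).im) 0 b := by
  have hint := h.intervalIntegrable_velocity i hb
  have him : IntervalIntegrable
      (fun s => ((V i : ℂ) * Complex.exp ((γ i s : ℂ) * Complex.I)).im) volume 0 b :=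
    ⟨hint.1.im, hint.2.im⟩
  refine ((AbsolutelyContinuousOnInterval.const (P i 0).im 0 b).add
    (him.absolutelyContinuousOnInterval_intervalIntegral left_mem_uIcc)).congr_on fun t ht => ?_
  rw [uIcc_of_le hb.1] at ht
  have ht' := hb.mono ht.1 ht.2
  have := Complex.imCLM.intervalIntegral_comp_comm (h.intervalIntegrable_velocity i ht')
  simp only [Complex.imCLM_apply] at this
  simp only [Pi.add_apply, this, h.position_eq i t ht', Complex.add_im]

theorem ae_hasDerivAt_heading (h : IsGuidedMotion G T V P γ) (i : Fin n) {b : ℝ}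
    (hb : Engaged T P b) : ∀ᵐ t, t ∈ Ioo 0 b → HasDerivAt (γ i)
      (guidanceAccel G T V (fun j => P j t) (fun j => γ j t) i / V i) t := by
  filter_upwards [(h.intervalIntegrable_turnRate i b hb).ae_hasDerivAt_integral] with t ht htm
  have hd := (ht (by rw [uIcc_of_le hb.1]; exact Ioo_subset_Icc_self htm) 0
    left_mem_uIcc).const_add (γ i 0)
  refine hd.congr_of_eventuallyEq ?_
  filter_upwards [Ioo_mem_nhds htm.1 htm.2] with u hu
  exact h.heading_eq i u (hb.mono hu.1.le hu.2.le)

theorem ae_hasDerivAt_position (h : IsGuidedMotion G T V P γ) (i : Fin n) {b : ℝ}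
    (hb : Engaged T P b) : ∀ᵐ t, t ∈ Ioo 0 b → HasDerivAt (P i)
      ((V i : ℂ) * Complex.exp ((γ i t : ℂ) * Complex.I)) t := by
  filter_upwards [(h.intervalIntegrable_velocity i hb).ae_hasDerivAt_integral] with t ht htm
  have hd := (ht (by rw [uIcc_of_le hb.1]; exact Ioo_subset_Icc_self htm) 0
    left_mem_uIcc).const_add (P i 0)
  refine hd.congr_of_eventuallyEq ?_
  filter_upwards [Ioo_mem_nhds htm.1 htm.2] with u hu
  exact h.position_eq i u (hb.mono hu.1.le hu.2.le)

theorem isRelMotion (h : IsGuidedMotion G T V P γ) (hV : ∀ i, 0 < V i) (i : Fin n) {b : ℝ}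
    (hb : Engaged T P b) : IsRelMotion (V i) (circularTimes G T V P γ i)
      (fun t => (relPos T (P i t) (γ i t)).re) (fun t => (relPos T (P i t) (γ i t)).im) 0 b := by
  have hγ := h.ac_heading i hb
  have hcos := hγ.comp_contDiffAt (g := Real.cos) fun t _ => Real.contDiff_cos.contDiffAt
  have hsin := hγ.comp_contDiffAt (g := Real.sin) fun t _ => Real.contDiff_sin.contDiffAt
  have hre := (AbsolutelyContinuousOnInterval.const T.re 0 b).sub (h.ac_re_position i hb)
  have him := (AbsolutelyContinuousOnInterval.const T.im 0 b).sub (h.ac_im_position i hb)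
  refine ⟨hb.1, ?_, ?_, fun t ht => ?_, ?_⟩
  · exact ((hre.mul hcos).add (him.mul hsin)).congr_on fun t _ => by simp [re_relPos]
  · exact ((him.mul hcos).sub (hre.mul hsin)).congr_on fun t _ => by simp [im_relPos]
  · have := dist_pos.2 (hb.2 i t ht)
    rw [← dist_sq_eq]; positivity
  · filter_upwards [h.ae_hasDerivAt_heading i hb, h.ae_hasDerivAt_position i hb] with t h1 h2 htm
    set g := guidanceAccel G T V (fun j => P j t) (fun j => γ j t) i / V i with hg
    -- In complex form the relative dynamics are `z' = -V - i g z`; real and imaginary parts give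
    -- the two equations.
    have hd : HasDerivAt (fun t => relPos T (P i t) (γ i t))
        (-(V i : ℂ) - (g : ℂ) * Complex.I * relPos T (P i t) (γ i t)) t := by
      have he := (((h1 htm).ofReal_comp.mul_const Complex.I).fun_neg).cexp
      refine (((h2 htm).const_sub T).fun_mul he).congr_deriv ?_
      have hee : Complex.exp ((γ i t : ℂ) * Complex.I) *
          Complex.exp (-((γ i t : ℂ) * Complex.I)) = 1 := by
        rw [← Complex.exp_add, add_neg_cancel, Complex.exp_zero]
      unfold relPos
      linear_combination (-(V i : ℂ)) * hee
    have hdr := Complex.reCLM.hasFDerivAt.comp_hasDerivAt t hd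
    have hdi := Complex.imCLM.hasFDerivAt.comp_hasDerivAt t hd
    refine ⟨g, hdr.congr_deriv ?_, hdi.congr_deriv ?_, fun hC => ?_, fun hC => ?_⟩
    · simp
    · simp
    · rw [hg, guidanceAccel_of_mem hC,
        circularAccel_div (hV i) (hb.2 i t (Ioo_subset_Icc_self htm))]
    · rw [hg, guidanceAccel_of_notMem hC, zero_div]

end IsGuidedMotion
theorem eqOn_Icc_of_eqOn_Ico {f g : ℝ → ℂ} {a b : ℝ} (hab : a < b) (hf : ContinuousOn f (Icc a b))
    (hg : ContinuousOn g (Icc a b)) (h : EqOn f g (Ico a b)) : EqOn f g (Icc a b) :=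
  h.of_subset_closure hf hg Ico_subset_Icc_self (closure_Ico hab.ne).ge

/-! ### Engagements with complete communication. -/

/-- A guided motion on a complete communication digraph in which initially no pursuer is at the
target and no lead angle is `0` or `π`. -/
structure IsCompleteEngagement (G : Digraph (Fin n)) (T : ℂ) (V : Fin n → ℝ)
    (P : Fin n → ℝ → ℂ) (γ : Fin n → ℝ → ℝ) : Prop where
  adj : ∀ i j, i ≠ j → G.Adj i j
  speed_pos : ∀ i, 0 < V i
  ne : ∀ i, P i 0 ≠ T
  leadAngle_ne : ∀ i, leadAngle T (P i 0) (γ i 0) ≠ 0 ∧ leadAngle T (P i 0) (γ i 0) ≠ Real.pi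
  motion : IsGuidedMotion G T V P γ

namespace IsCompleteEngagement

theorem engaged_zero (h : IsCompleteEngagement G T V P γ) : Engaged T P 0 :=
  ⟨le_rfl, fun j s hs => by rw [le_antisymm hs.2 hs.1]; exact h.ne j⟩

theorem im_ne_zero (h : IsCompleteEngagement G T V P γ) (i : Fin n) {t : ℝ}
    (ht : Engaged T P t) : (relPos T (P i t) (γ i t)).im ≠ 0 :=
  (h.motion.isRelMotion h.speed_pos i ht).snd_ne_zero (h.speed_pos i)
    (im_relPos_ne_zero (h.leadAngle_ne i).1 (h.leadAngle_ne i).2) t ⟨ht.1, le_rfl⟩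

theorem isRelMotion_abs (h : IsCompleteEngagement G T V P γ) (i : Fin n) {b : ℝ}
    (hb : Engaged T P b) : IsRelMotion (V i) (circularTimes G T V P γ i)
      (fun t => (relPos T (P i t) (γ i t)).re) (fun t => |(relPos T (P i t) (γ i t)).im|) 0 b :=
  (h.motion.isRelMotion h.speed_pos i hb).abs_snd fun _ ht =>
    h.im_ne_zero i (hb.mono ht.1 ht.2)

theorem estTime_eq (h : IsCompleteEngagement G T V P γ) (i : Fin n) {t : ℝ}
    (ht : Engaged T P t) : estTime T (V i) (P i t) (γ i t) =
      relTime (V i) (relPos T (P i t) (γ i t)).re |(relPos T (P i t) (γ i t)).im| :=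
  estTime_eq_relTime (h.speed_pos i) (ht.ne i) (h.im_ne_zero i ht)

theorem estTime_pos (h : IsCompleteEngagement G T V P γ) (i : Fin n) {t : ℝ}
    (ht : Engaged T P t) : 0 < estTime T (V i) (P i t) (γ i t) := by
  rw [h.estTime_eq i ht]
  exact relTime_pos (h.speed_pos i) (abs_pos.2 (h.im_ne_zero i ht))

theorem ac_estTime_add (h : IsCompleteEngagement G T V P γ) (i : Fin n) {b : ℝ}
    (hb : Engaged T P b) : AbsolutelyContinuousOnInterval
      (fun t => estTime T (V i) (P i t) (γ i t) + t) 0 b := by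
  refine ((h.isRelMotion_abs i hb).ac_relTime_add (h.speed_pos i) fun t ht =>
    abs_pos.2 (h.im_ne_zero i (hb.mono ht.1 ht.2))).congr_on fun t ht => ?_
  rw [uIcc_of_le hb.1] at ht
  simp only [h.estTime_eq i (hb.mono ht.1 ht.2)]

theorem ae_hasDerivAt_estTime_add (h : IsCompleteEngagement G T V P γ) (i : Fin n) {b : ℝ}
    (hb : Engaged T P b) : ∀ᵐ t, t ∈ Ioo 0 b → ∃ d, 0 ≤ d ∧
      (t ∈ circularTimes G T V P γ i → d = 0) ∧
      HasDerivAt (fun t => estTime T (V i) (P i t) (γ i t) + t) d t := by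
  filter_upwards [(h.isRelMotion_abs i hb).ae_hasDerivAt_relTime_add (h.speed_pos i) fun t ht =>
    abs_pos.2 (h.im_ne_zero i (hb.mono ht.1 ht.2))] with t ht htm
  obtain ⟨d, h0, hC, hd⟩ := ht htm
  refine ⟨d, h0, hC, hd.congr_of_eventuallyEq ?_⟩
  filter_upwards [Ioo_mem_nhds htm.1 htm.2] with u hu
  rw [h.estTime_eq i (hb.mono hu.1.le hu.2.le)]

theorem monotoneOn_estTime_add (h : IsCompleteEngagement G T V P γ) (i : Fin n) {b : ℝ}
    (hb : Engaged T P b) :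
    MonotoneOn (fun t => estTime T (V i) (P i t) (γ i t) + t) (Icc 0 b) := by
  refine (h.ac_estTime_add i hb).monotoneOn_of_ae_deriv_nonneg ?_
  filter_upwards [h.ae_hasDerivAt_estTime_add i hb] with t ht htm
  obtain ⟨d, h0, -, hd⟩ := ht htm
  exact ⟨d, h0, hd⟩

/-- This is where completeness of the digraph enters: comparison with out-neighbours becomes
comparison with everyone, the case `j = i` being trivial. -/
theorem mem_circularTimes_iff (h : IsCompleteEngagement G T V P γ) (i : Fin n) (t : ℝ) :
    t ∈ circularTimes G T V P γ i ↔
      ∀ j, estTime T (V j) (P j t) (γ j t) ≤ estTime T (V i) (P i t) (γ i t) := by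
  simp only [circularTimes, mem_ofPred_eq, not_exists, not_and, not_lt]
  refine forall_congr' fun j => ⟨fun H => ?_, fun H _ => H⟩
  by_cases hij : i = j
  · rw [hij]
  · exact H (h.adj i j hij)

/-- The largest estimated time of interception decreases at unit rate. -/
theorem exists_max (h : IsCompleteEngagement G T V P γ) (i₀ : Fin n) :
    ∃ S, ∀ t, Engaged T P t → (∀ j, estTime T (V j) (P j t) (γ j t) + t ≤ S) ∧
      ∃ j, estTime T (V j) (P j t) (γ j t) + t = S := by
  have hne : (Finset.univ : Finset (Fin n)).Nonempty := ⟨i₀, Finset.mem_univ _⟩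
  -- The `+ 0` is the summand `t` at time `0`.
  refine ⟨Finset.univ.sup' hne fun j => estTime T (V j) (P j 0) (γ j 0) + 0, fun t ht => ?_⟩
  rw [← AbsolutelyContinuousOnInterval.sup'_eq_left hne
    (f := fun j t => estTime T (V j) (P j t) (γ j t) + t) (a := 0) (b := t)
    (fun j _ => h.ac_estTime_add j ht) ?_ t ⟨ht.1, le_rfl⟩]
  · refine ⟨fun j => Finset.le_sup' (fun j => estTime T (V j) (P j t) (γ j t) + t)
      (Finset.mem_univ j), ?_⟩
    obtain ⟨j, -, hj⟩ := Finset.exists_mem_eq_sup' hne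
      fun j => estTime T (V j) (P j t) (γ j t) + t
    exact ⟨j, hj.symm⟩
  · intro j _
    filter_upwards [h.ae_hasDerivAt_estTime_add j ht] with s hs hsm hmax
    obtain ⟨d, -, hC, hd⟩ := hs hsm
    rw [hC ((h.mem_circularTimes_iff j s).2 fun k => by
      simpa using hmax k (Finset.mem_univ k))] at hd
    exact hd

theorem mem_circularTimes_iff_eq (h : IsCompleteEngagement G T V P γ) {S t : ℝ}
    (hS : (∀ j, estTime T (V j) (P j t) (γ j t) + t ≤ S) ∧
      ∃ j, estTime T (V j) (P j t) (γ j t) + t = S) (i : Fin n) :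
    t ∈ circularTimes G T V P γ i ↔ estTime T (V i) (P i t) (γ i t) + t = S := by
  rw [h.mem_circularTimes_iff]
  obtain ⟨hle, k, hk⟩ := hS
  constructor
  · intro H
    have := H k
    exact le_antisymm (hle i) (by linarith)
  · intro H j
    have := hle j
    linarith

/-- A pursuer that follows the circular path keeps following it. -/
theorem mem_circularTimes_of_le (h : IsCompleteEngagement G T V P γ) {i : Fin n} {s t : ℝ}
    (hs0 : 0 ≤ s) (hst : s ≤ t) (ht : Engaged T P t) (hs : s ∈ circularTimes G T V P γ i) :
    t ∈ circularTimes G T V P γ i := by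
  obtain ⟨S, hS⟩ := h.exists_max i
  rw [h.mem_circularTimes_iff_eq (hS s (ht.mono hs0 hst))] at hs
  rw [h.mem_circularTimes_iff_eq (hS t ht)]
  refine le_antisymm ((hS t ht).1 i) ?_
  rw [← hs]
  exact h.monotoneOn_estTime_add i ht ⟨hs0, hst⟩ ⟨ht.1, le_rfl⟩ hst

/-- The endpoint `b` is included by continuity, so that `b` may be the moment at which the
engagement ends. -/
theorem position_eq_of_straight (h : IsCompleteEngagement G T V P γ) {i : Fin n} {b : ℝ}
    (hb : 0 < b) (heng : ∀ t ∈ Ico 0 b, Engaged T P t)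
    (hC : ∀ t ∈ Ico 0 b, t ∉ circularTimes G T V P γ i) :
    ∀ t ∈ Icc 0 b, P i t =
      P i 0 + (t : ℂ) * ((V i : ℂ) * Complex.exp ((γ i 0 : ℂ) * Complex.I)) := by
  have hγ : ∀ t ∈ Ico 0 b, γ i t = γ i 0 := by
    intro t ht
    rw [h.motion.heading_eq i t (heng t ht), add_eq_left]
    refine intervalIntegral.integral_zero_ae (Filter.Eventually.of_forall fun s hs => ?_)
    rw [uIoc_of_le ht.1] at hs
    rw [guidanceAccel_of_notMem (hC s ⟨hs.1.le, hs.2.trans_lt ht.2⟩), zero_div]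
  refine eqOn_Icc_of_eqOn_Ico hb ((h.motion.continuousOn_position i).mono Icc_subset_Ici_self)
    (by fun_prop) fun t ht => ?_
  rw [h.motion.position_eq i t (heng t ht)]
  congr 1
  rw [intervalIntegral.integral_congr
    (g := fun _ => (V i : ℂ) * Complex.exp ((γ i 0 : ℂ) * Complex.I))]
  · rw [intervalIntegral.integral_const, sub_zero, Complex.real_smul]
  · intro s hs
    rw [uIcc_of_le ht.1] at hs
    simp only [hγ s ⟨hs.1, hs.2.trans_lt ht.2⟩]

/-- Meeting `T` on this ray would make the initial relative position a nonnegative real, with lead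
angle `0`. -/
theorem straight_ne (h : IsCompleteEngagement G T V P γ) (i : Fin n) {t : ℝ} (ht : 0 ≤ t) :
    P i 0 + (t : ℂ) * ((V i : ℂ) * Complex.exp ((γ i 0 : ℂ) * Complex.I)) ≠ T := by
  intro hT
  apply (h.leadAngle_ne i).1
  have hz : relPos T (P i 0) (γ i 0) = ((t * V i : ℝ) : ℂ) := by
    rw [relPos, ← hT, add_sub_cancel_left, mul_assoc, mul_assoc, ← Complex.exp_add,
      add_neg_cancel, Complex.exp_zero, mul_one, Complex.ofReal_mul]
  rw [leadAngle_eq_arg, hz]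
  exact Complex.arg_ofReal_of_nonneg (mul_nonneg ht (h.speed_pos i).le)

/-- On the circular path, the lead angle, the distance to the target and the heading are explicit
functions of time. -/
theorem exists_circular (h : IsCompleteEngagement G T V P γ) {i : Fin n} {s b S : ℝ}
    (hs0 : 0 ≤ s) (hsb : s < b) (heng : ∀ t ∈ Ico 0 b, Engaged T P t)
    (hS : ∀ t, Engaged T P t → (∀ j, estTime T (V j) (P j t) (γ j t) + t ≤ S) ∧
      ∃ j, estTime T (V j) (P j t) (γ j t) + t = S)
    (hC : s ∈ circularTimes G T V P γ i) :
    ∃ κ : ℝ, κ ≠ 0 ∧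
      (∀ t ∈ Ico s b, leadAngle T (P i t) (γ i t) = V i * κ * (S - t)) ∧
      (∀ t ∈ Icc s b, κ * dist (P i t) T = Real.sin (V i * κ * (S - t))) ∧
      (∀ t ∈ Ico s b, circularAccel T (V i) (P i t) (γ i t) / V i = 2 * V i * κ) ∧
      ∀ t ∈ Ico s b, γ i t = γ i s + 2 * V i * κ * (t - s) := by
  have heng' : ∀ t ∈ Ico s b, Engaged T P t := fun t ht => heng t ⟨hs0.trans ht.1, ht.2⟩
  have hs : s ∈ Ico s b := ⟨le_rfl, hsb⟩
  have hCt : ∀ t ∈ Ico s b, t ∈ circularTimes G T V P γ i := fun t ht =>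
    h.mem_circularTimes_of_le hs0 ht.1 (heng' t ht) hC
  -- This is `sin θ / R`, half the signed curvature of the circular path; its constant value is `κ`.
  set q : ℝ → ℝ := fun t => (relPos T (P i t) (γ i t)).im /
    ((relPos T (P i t) (γ i t)).re ^ 2 + (relPos T (P i t) (γ i t)).im ^ 2) with hq
  have hqt : ∀ t ∈ Ico s b, q t = q s := fun t ht =>
    ((h.motion.isRelMotion h.speed_pos i (heng' t ht)).mono hs0 ht.1 le_rfl).snd_div_normSq_eq
      (fun u hu => hCt u ⟨hu.1, hu.2.trans_lt ht.2⟩) t ⟨ht.1, le_rfl⟩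
  have hV := h.speed_pos i
  have hκ : q s ≠ 0 := by
    rw [hq]
    simp only
    rw [← dist_sq_eq]
    exact div_ne_zero (h.im_ne_zero i (heng' s hs))
      (pow_ne_zero 2 (dist_ne_zero.2 ((heng' s hs).ne i)))
  have hacc : ∀ t ∈ Ico s b, circularAccel T (V i) (P i t) (γ i t) / V i = 2 * V i * q s := by
    intro t ht
    rw [circularAccel_div hV ((heng' t ht).ne i), ← hqt t ht, mul_div_assoc]
  -- While circling, the estimated time is both `S - t` and `θ / (Vκ)`.
  have hlead : ∀ t ∈ Ico s b, leadAngle T (P i t) (γ i t) = V i * q s * (S - t) := by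
    intro t ht
    have h1 := (h.mem_circularTimes_iff_eq (hS t (heng' t ht)) i).1 (hCt t ht)
    have h2 := estTime_eq_div (γ := γ i t) (V := V i) ((heng' t ht).ne i)
    change _ = _ / (V i * q t) at h2
    rw [hqt t ht, eq_div_iff (mul_ne_zero hV.ne' hκ)] at h2
    rw [← h2, ← h1]; ring
  refine ⟨q s, hκ, hlead, ?_, hacc, ?_⟩
  · have hcont : ContinuousOn (P i) (Icc s b) :=
      (h.motion.continuousOn_position i).mono fun t ht => hs0.trans ht.1
    -- The identity is extended to `t = b` by continuity, since the distance may vanish there and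
    -- cannot be cancelled.
    refine EqOn.of_subset_closure (s := Ico s b) (fun t ht => ?_)
      (by fun_prop) (by fun_prop) Ico_subset_Icc_self (closure_Ico hsb.ne).ge
    have hd : dist (P i t) T ≠ 0 := dist_ne_zero.2 ((heng' t ht).ne i)
    have h1 := dist_mul_sin_leadAngle T (P i t) (γ i t)
    have h2 : q t * dist (P i t) T ^ 2 = (relPos T (P i t) (γ i t)).im := by
      rw [hq]
      simp only
      rw [← dist_sq_eq]
      field_simp
    rw [hqt t ht, ← h1, hlead t ht] at h2
    have h3 : dist (P i t) T * (q s * dist (P i t) T) =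
        dist (P i t) T * Real.sin (V i * q s * (S - t)) := by rw [← h2]; ring
    exact mul_left_cancel₀ hd h3
  · intro t ht
    have hst := h.motion.heading_eq i t (heng' t ht)
    have hss := h.motion.heading_eq i s (heng' s hs)
    have hsub := intervalIntegral.integral_interval_sub_left
      (h.motion.intervalIntegrable_turnRate i t (heng' t ht))
      (h.motion.intervalIntegrable_turnRate i s (heng' s hs))
    rw [intervalIntegral.integral_congr (a := s) (b := t) (g := fun _ => 2 * V i * q s)] at hsub
    · rw [intervalIntegral.integral_const, smul_eq_mul] at hsub
      linarith
    · intro u hu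
      rw [uIcc_of_le ht.1] at hu
      have hu' : u ∈ Ico s b := ⟨hu.1, hu.2.trans_lt ht.2⟩
      simp only
      rw [guidanceAccel_of_mem (hCt u hu'), hacc u hu']

theorem isCircularArcOn (h : IsCompleteEngagement G T V P γ) {i : Fin n} {s b ω : ℝ}
    (hs0 : 0 ≤ s) (hsb : s < b) (heng : ∀ t ∈ Ico 0 b, Engaged T P t) (hω : ω ≠ 0)
    (hγ : ∀ t ∈ Ico s b, γ i t = γ i s + ω * (t - s)) : IsCircularArcOn (P i) s b := by
  -- The vector from the centre to the pursuer at time `s`: the antiderivative of the rotating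
  -- velocity, evaluated at `s`.
  set w : ℂ := (V i : ℂ) / (ω * Complex.I) * Complex.exp ((γ i s : ℂ) * Complex.I) with hw
  have hωI : (ω : ℂ) * Complex.I ≠ 0 := mul_ne_zero (Complex.ofReal_ne_zero.2 hω) Complex.I_ne_zero
  have hw0 : w ≠ 0 := mul_ne_zero
    (div_ne_zero (Complex.ofReal_ne_zero.2 (h.speed_pos i).ne') hωI) (Complex.exp_ne_zero _)
  refine ⟨P i s - w, ω, fun H => hw0 (by linear_combination H), hω, ?_⟩
  have hcont : ContinuousOn (P i) (Icc s b) :=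
    (h.motion.continuousOn_position i).mono fun t ht => hs0.trans ht.1
  refine eqOn_Icc_of_eqOn_Ico hsb hcont (by fun_prop) fun t ht => ?_
  have het := heng t ⟨hs0.trans ht.1, ht.2⟩
  have hes := heng s ⟨hs0, hsb⟩
  have hpt := h.motion.position_eq i t het
  have hps := h.motion.position_eq i s hes
  have hsub := intervalIntegral.integral_interval_sub_left
    (h.motion.intervalIntegrable_velocity i het) (h.motion.intervalIntegrable_velocity i hes)
  have hd : ∀ u : ℝ, HasDerivAt
      (fun u : ℝ => w * Complex.exp (((ω * (u - s) : ℝ) : ℂ) * Complex.I))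
      ((V i : ℂ) * Complex.exp (((γ i s + ω * (u - s) : ℝ) : ℂ) * Complex.I)) u := by
    intro u
    have h1 : HasDerivAt (fun u : ℝ => ω * (u - s)) ω u := by
      simpa using ((hasDerivAt_id u).sub_const s).const_mul ω
    refine (((h1.ofReal_comp.mul_const Complex.I).cexp).const_mul w).congr_deriv ?_
    have hω' : (ω : ℂ) ≠ 0 := Complex.ofReal_ne_zero.2 hω
    rw [hw, Complex.ofReal_add, add_mul, Complex.exp_add]
    field_simp
  have hint : ∫ u in s..t, (V i : ℂ) * Complex.exp ((γ i u : ℂ) * Complex.I) =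
      w * Complex.exp (((ω * (t - s) : ℝ) : ℂ) * Complex.I) - w := by
    rw [intervalIntegral.integral_congr (g := fun u : ℝ =>
      (V i : ℂ) * Complex.exp (((γ i s + ω * (u - s) : ℝ) : ℂ) * Complex.I)),
      intervalIntegral.integral_eq_sub_of_hasDerivAt (fun u _ => hd u)
        (Continuous.intervalIntegrable (by fun_prop) _ _)]
    · simp
    · intro u hu
      rw [uIcc_of_le ht.1] at hu
      simp only
      rw [hγ u ⟨hu.1, hu.2.trans_lt ht.2⟩]
  linear_combination hpt - hps + hsub + hint

/-- The engagement ends at the initial value of the largest estimated time of interception. -/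
theorem engaged_iff (h : IsCompleteEngagement G T V P γ) (i₀ : Fin n) {S : ℝ}
    (hS : ∀ t, Engaged T P t → (∀ j, estTime T (V j) (P j t) (γ j t) + t ≤ S) ∧
      ∃ j, estTime T (V j) (P j t) (γ j t) + t = S) (t : ℝ) :
    Engaged T P t ↔ t ∈ Ico 0 S := by
  have hlt : ∀ t, Engaged T P t → t < S := fun t ht => by
    have := (hS t ht).1 i₀
    have := h.estTime_pos i₀ ht
    linarith
  refine ⟨fun ht => ⟨ht.1, hlt t ht⟩, fun ht => ?_⟩
  by_contra hne
  -- The set of all hitting times is closed, being a finite union of closed sets, so it has a first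
  -- element `b`, reached by some pursuer `k`.
  set Z : Set ℝ := ⋃ j, Ici 0 ∩ P j ⁻¹' {T} with hZ
  have hZc : IsClosed Z := isClosed_iUnion_of_finite fun j =>
    (h.motion.continuousOn_position j).preimage_isClosed_of_isClosed isClosed_Ici
      isClosed_singleton
  have hmem : ∃ u ∈ Z, u ≤ t := by
    simp only [Engaged, not_and, not_forall, not_not] at hne
    obtain ⟨j, u, hu, hju⟩ := hne ht.1
    exact ⟨u, mem_iUnion.2 ⟨j, hu.1, hju⟩, hu.2⟩
  obtain ⟨u, huZ, hut⟩ := hmem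
  have hbdd : BddBelow Z := ⟨0, fun v hv => by
    obtain ⟨j, hj⟩ := mem_iUnion.1 hv
    exact hj.1⟩
  have hleast := hZc.isLeast_csInf ⟨u, huZ⟩ hbdd
  set b := sInf Z
  have hbS : b < S := (hleast.2 huZ).trans_lt (hut.trans_lt ht.2)
  obtain ⟨k, hk0, hkT⟩ := mem_iUnion.1 hleast.1
  have hb : 0 < b := lt_of_le_of_ne hk0 fun hb0 => h.ne k (by rw [hb0]; exact hkT)
  have heng : ∀ t ∈ Ico 0 b, Engaged T P t := fun t ht => ⟨ht.1, fun j s hs hjs =>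
    absurd (hleast.2 (mem_iUnion.2 ⟨j, hs.1, hjs⟩)) (not_le.2 (hs.2.trans_lt ht.2))⟩
  by_cases hC : ∃ s ∈ Ico 0 b, s ∈ circularTimes G T V P γ k
  · obtain ⟨s, hs, hsC⟩ := hC
    obtain ⟨κ, hκ, hlead, hdist, -, -⟩ := h.exists_circular hs.1 hs.2 heng hS hsC
    have hV := h.speed_pos k
    have h1 := hdist b ⟨hs.2.le, le_rfl⟩
    rw [hkT, dist_self, mul_zero] at h1
    have h2 := hlead s ⟨le_rfl, hs.2⟩
    have h3 : |V k * κ * (S - s)| ≤ Real.pi := by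
      rw [← h2]; exact Complex.abs_arg_le_pi _
    have hc : V k * κ ≠ 0 := mul_ne_zero hV.ne' hκ
    -- Since `s < b < S`, the angle at `b` is nonzero and strictly smaller in size than the lead
    -- angle at `s`, so its sine cannot vanish.
    have h4 : |V k * κ * (S - b)| < Real.pi := by
      refine lt_of_lt_of_le ?_ h3
      rw [abs_mul, abs_mul (V k * κ) (S - s), abs_of_pos (sub_pos.2 hbS),
        abs_of_pos (sub_pos.2 (hs.2.trans hbS))]
      have := abs_pos.2 hc
      have := hs.2
      gcongr
    rw [abs_lt] at h4
    exact mul_ne_zero hc (sub_pos.2 hbS).ne'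
      ((Real.sin_eq_zero_iff_of_lt_of_lt h4.1 h4.2).1 h1.symm)
  · push Not at hC
    have := h.position_eq_of_straight hb heng hC b ⟨hb.le, le_rfl⟩
    exact h.straight_ne k hb.le (by rw [← this]; exact hkT)

/-- Every pursuer catches up with the largest estimated time of interception. -/
theorem exists_mem_circularTimes (h : IsCompleteEngagement G T V P γ) (i : Fin n) {S : ℝ}
    (hS : ∀ t, Engaged T P t → (∀ j, estTime T (V j) (P j t) (γ j t) + t ≤ S) ∧
      ∃ j, estTime T (V j) (P j t) (γ j t) + t = S) :
    ∃ s ∈ Ico 0 S, s ∈ circularTimes G T V P γ i := by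
  by_contra! hC
  have heng : ∀ t ∈ Ico 0 S, Engaged T P t := fun t ht => (h.engaged_iff i hS t).2 ht
  have hS0 : 0 < S := ((h.engaged_iff i hS 0).1 h.engaged_zero).2
  have hP := h.position_eq_of_straight hS0 heng hC
  have hV := h.speed_pos i
  have hcont : ContinuousOn (P i) (Icc 0 S) :=
    (h.motion.continuousOn_position i).mono Icc_subset_Ici_self
  -- The bound `R ≤ Vτ ≤ V(S - t)` passes to the limit `t → S` and forces the pursuer onto `T`.
  have hle : dist (P i S) T ≤ V i * (S - S) := by
    refine ContinuousWithinAt.closure_le (s := Ico 0 S) (f := fun t => dist (P i t) T)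
      (g := fun t => V i * (S - t)) (x := S) ?_ ?_ ?_ fun t ht => ?_
    · rw [closure_Ico hS0.ne]; exact ⟨hS0.le, le_rfl⟩
    · exact ((hcont S ⟨hS0.le, le_rfl⟩).mono Ico_subset_Icc_self).dist continuousWithinAt_const
    · fun_prop
    · have him := h.im_ne_zero i (heng t ht)
      have h1 := dist_le_mul_estTime (T := T) (p := P i t) (γ := γ i t) hV
        (fun H => him (Complex.arg_eq_zero_iff.1 H).2) (fun H => him (Complex.arg_eq_pi_iff.1 H).2)
      have h2 := (hS t (heng t ht)).1 i
      refine h1.trans ?_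
      gcongr
      linarith
  rw [sub_self, mul_zero] at hle
  have hT : P i S = T := dist_le_zero.1 hle
  exact h.straight_ne i hS0.le (by rw [← hP S ⟨hS0.le, le_rfl⟩, hT])

end IsCompleteEngagement

end Pursuit

/-! ### The single switch of a non-leader. -/

theorem mainTheorem7 {n : ℕ} (G : Digraph (Fin n))
    (hG : ∀ i j, i ≠ j → G.Adj i j)
    (T : ℂ) (V : Fin n → ℝ) (hV : ∀ i, 0 < V i)
    (P : Fin n → ℝ → ℂ) (γ : Fin n → ℝ → ℝ)
    (hP : ∀ i, P i 0 ≠ T)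
    (hθ : ∀ i, Pursuit.leadAngle T (P i 0) (γ i 0) ≠ 0 ∧
      Pursuit.leadAngle T (P i 0) (γ i 0) ≠ Real.pi)
    (hmotion : Pursuit.IsGuidedMotion G T V P γ)
    (i : Fin n) (hi : ¬ Pursuit.IsLeader T V P γ i) :
    ∃ tf : ℝ, IsLeast {t : ℝ | 0 ≤ t ∧ P i t = T} tf ∧
      ∃! s : ℝ, s ∈ Set.Ioo 0 tf ∧
        Pursuit.IsStraightOn (P i) 0 s ∧
        Pursuit.IsCircularArcOn (P i) s tf ∧
        (∀ t ∈ Set.Ico 0 s,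
          Pursuit.guidanceAccel G T V (fun j => P j t) (fun j => γ j t) i = 0) ∧
        (∀ t ∈ Set.Ico s tf,
          Pursuit.guidanceAccel G T V (fun j => P j t) (fun j => γ j t) i =
              Pursuit.circularAccel T (V i) (P i t) (γ i t) ∧
            Pursuit.circularAccel T (V i) (P i t) (γ i t) ≠ 0) := by
  have h : Pursuit.IsCompleteEngagement G T V P γ := ⟨hG, hV, hP, hθ, hmotion⟩
  obtain ⟨S, hS⟩ := h.exists_max i
  have heng : ∀ t ∈ Ico 0 S, Pursuit.Engaged T P t := fun t ht => (h.engaged_iff i hS t).2 ht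
  have hS0 : 0 < S := ((h.engaged_iff i hS 0).1 h.engaged_zero).2
  have h0 : (0 : ℝ) ∉ Pursuit.circularTimes G T V P γ i := fun h0 => hi fun t ht =>
    (h.mem_circularTimes_iff i t).1 (h.mem_circularTimes_of_le le_rfl ht.1 ht h0)
  obtain ⟨s₁, hs₁, hs₁C⟩ := h.exists_mem_circularTimes i hS
  -- Writing the circling times up to `s₁` as a level set of a continuous function makes them
  -- closed, so there is a first one.
  set Z : Set ℝ := Icc 0 s₁ ∩
    (fun t => Pursuit.estTime T (V i) (P i t) (γ i t) + t) ⁻¹' {S} with hZ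
  have hZiff : ∀ t ∈ Icc 0 s₁, t ∈ Z ↔ t ∈ Pursuit.circularTimes G T V P γ i := fun t ht => by
    rw [h.mem_circularTimes_iff_eq (hS t (heng t ⟨ht.1, ht.2.trans_lt hs₁.2⟩))]
    exact ⟨fun H => H.2, fun H => ⟨ht, H⟩⟩
  have hZc : IsClosed Z := by
    refine ContinuousOn.preimage_isClosed_of_isClosed ?_ isClosed_Icc isClosed_singleton
    simpa only [uIcc_of_le hs₁.1] using (h.ac_estTime_add i (heng s₁ hs₁)).continuousOn
  have hleast := hZc.isLeast_csInf ⟨s₁, (hZiff s₁ ⟨hs₁.1, le_rfl⟩).2 hs₁C⟩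
    ⟨0, fun t ht => ht.1.1⟩
  set s := sInf Z
  have hsI : s ∈ Icc 0 s₁ := hleast.1.1
  have hsC := (hZiff s hsI).1 hleast.1
  have hs0 : 0 < s := lt_of_le_of_ne hsI.1 fun H => h0 (by rwa [← H] at hsC)
  have hsS : s < S := hsI.2.trans_lt hs₁.2
  have hnot : ∀ t ∈ Ico 0 s, t ∉ Pursuit.circularTimes G T V P γ i := fun t ht htC =>
    absurd (hleast.2 ((hZiff t ⟨ht.1, ht.2.le.trans hsI.2⟩).2 htC)) (not_le.2 ht.2)
  have hmem : ∀ t ∈ Ico s S, t ∈ Pursuit.circularTimes G T V P γ i := fun t ht =>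
    h.mem_circularTimes_of_le hs0.le ht.1 (heng t ⟨hs0.le.trans ht.1, ht.2⟩) hsC
  obtain ⟨κ, hκ, -, hdist, hacc, hγ⟩ := h.exists_circular hs0.le hsS heng hS hsC
  have hω : 2 * V i * κ ≠ 0 := mul_ne_zero (mul_ne_zero two_ne_zero (hV i).ne') hκ
  have hzero : ∀ t ∈ Ico 0 s,
      Pursuit.guidanceAccel G T V (fun j => P j t) (fun j => γ j t) i = 0 := fun t ht =>
    Pursuit.guidanceAccel_of_notMem (hnot t ht)
  have hcirc : ∀ t ∈ Ico s S,
      Pursuit.guidanceAccel G T V (fun j => P j t) (fun j => γ j t) i =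
        Pursuit.circularAccel T (V i) (P i t) (γ i t) ∧
      Pursuit.circularAccel T (V i) (P i t) (γ i t) ≠ 0 := fun t ht =>
    ⟨Pursuit.guidanceAccel_of_mem (hmem t ht), fun H => hω (by
      rw [← hacc t ht, H, zero_div])⟩
  refine ⟨S, ⟨⟨hS0.le, ?_⟩, ?_⟩, s, ⟨⟨hs0, hsS⟩, ?_, ?_, hzero, hcirc⟩, ?_⟩
  · have := hdist S ⟨hsS.le, le_rfl⟩
    rw [sub_self, mul_zero, Real.sin_zero] at this
    exact dist_eq_zero.1 ((mul_eq_zero.1 this).resolve_left hκ)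
  · rintro t ⟨ht0, htT⟩
    by_contra! htS
    exact (heng t ⟨ht0, htS⟩).ne i htT
  · refine ⟨(V i : ℂ) * Complex.exp ((γ i 0 : ℂ) * Complex.I), mul_ne_zero
      (Complex.ofReal_ne_zero.2 (hV i).ne') (Complex.exp_ne_zero _), fun t ht => ?_⟩
    rw [sub_zero]
    exact h.position_eq_of_straight hs0 (fun u hu => heng u ⟨hu.1, hu.2.trans hsS⟩) hnot t ht
  · exact h.isCircularArcOn hs0.le hsS heng hω hγ
  -- The control alone gives uniqueness: at the smaller of two distinct switching times it would be
  -- both zero and nonzero.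
  · rintro s' ⟨hs', -, -, hzero', hcirc'⟩
    rcases lt_trichotomy s' s with hlt | heq | hgt
    · have h1 := hcirc' s' ⟨le_rfl, hs'.2⟩
      exact absurd (h1.1.symm.trans (hzero s' ⟨hs'.1.le, hlt⟩)) h1.2
    · exact heq
    · have h1 := hcirc s ⟨le_rfl, hsS⟩
      exact absurd (h1.1.symm.trans (hzero' s ⟨hs0.le, hgt⟩)) h1.2
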